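/- **Theorem 2.** Consider $N$ TCP sources sharing one router of capacity $c>0$, where source $i$ establishes $\eta_i$ sessions and has propagation time $T_{p_i}$, forward delay $\tau_i^f>0$ and backward delay $\tau_i^b\ge 0$. Let $(x_{i_0},b_0)$, with $x_{i_0}>0$ and $b_0\ge 0$, be an equilibrium point: $\tau_{i_0}=T_{p_i}+b_0/c=\tau_i^f+\tau_i^b$, $\sum_i\eta_ix_{i_0}=c$, $p_{i_0}=\frac{2}{2+(x_{i_0}\tau_{i_0})^2}$. Put $$a_i=-\tfrac{1-p_{i_0}}{x_{i_0}\tau_{i_0}^2}-\tfrac{x_{i_0}p_{i_0}}{2},\quad h_i=-\tfrac{2(1-p_{i_0})}{c\,\tau_{i_0}^3},\quad f_i=-\tfrac{x_{i_0}}{\tau_{i_0}c},\quad e_i=-\tfrac1{\tau_{i_0}^2}-\tfrac{x_{i_0}^2}{2}.$$ The augmented linearized model has the state $\tilde x=(\delta x_1,\dots,\delta x_N,\delta b,d)^T\in\mathbb R^{N+2}$ (deviations of the flow rates and of the queue length from equilibrium, and the anomaly $d$), the delayed state $\tilde x_d(t)=(\delta x_1(t-\tau_1^f),\dots,\delta x_N(t-\tau_N^f),\delta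 b(t),d(t))^T$, an input $u(t)\in\mathbb R^N$, and reads $$\dot{\tilde x}(t)=\bar A\tilde x(t)+\bar A_d\tilde x_d(t)+\bar Bu(t),\qquad \tilde y(t)=\bar C\tilde x(t),$$ that is, for $1\le i\le N$, $$\dot{\delta x_i}(t)=a_i\,\delta x_i(t)+h_i\,\delta b(t)+f_i\sum_{j}\eta_j\,\delta x_j(t-\tau_j^f)+e_iu_i(t),$$ $$\dot{\delta b}(t)=d(t)+\sum_j\eta_j\,\delta x_j(t-\tau_j^f),\qquad \dot d(t)=0,\qquad \tilde y(t)=\delta b(t).$$ Let $\bar A_{d_i}$ be the $(N+2)\times(N+2)$ matrix whose $i$-th column is $\eta_i(f_1,\dots,f_N,1,0)^T$ and whose other columns are $0$, so that $\bar A_d\tilde x_d(t)=\sum_i\bar A_{d_i}\tilde x(t-\tau_i^f)$. Suppose that there are positive definite $(N+2)\times(N+2)$ matrices $P$, $Q_i$, $S_i$ ($i=1,\dots,N$) and a matrix $X\in\mathbb R^{(N+2)\times1}$ such that $$\begin{bmatrix}\Xi_1+\Xi_3&Y&\cdots&Y\\ Y^T&\frac1{(\tau_1^f)^2}S_1&&0\\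 \vdots&&\ddots&\\ Y^T&0&&\frac1{(\tau_N^f)^2}S_N\end{bmatrix}>0,$$ where $$\Xi_1=\begin{bmatrix}\Psi&-P\bar A_{d_1}&\cdots&-P\bar A_{d_N}\\-\bar A_{d_1}^TP&Q_1&&0\\ \vdots&&\ddots&\\-\bar A_{d_N}^TP&0&&Q_N\end{bmatrix},\qquad \Psi=-P\bar A-\bar A^TP+X\bar C+\bar C^TX^T-\sum_{i=1}^NQ_i,$$ $$\Xi_3=\sum_{i=1}^NM_i(2P-S_i)M_i^T,\qquad Y=\begin{bmatrix}P\bar A-X\bar C&P\bar A_{d_1}&\cdots&P\bar A_{d_N}\end{bmatrix}^T,$$ and $M_i$ is the block column of $N+1$ blocks of size $(N+2)\times(N+2)$ whose first block is $-\mathbf 1$, whose $(i+1)$-th block is $\mathbf 1$ and whose other blocks are $0$. Then, with the gain $L=P^{-1}X$, the system $$\dot{\hat x}(t)=\bar A\hat x(t)+\bar A_d\hat x_d(t)+\bar Bu(t)+L\bigl(\tilde y(t)-\bar C\hat x(t)\bigr)$$ is an observer for the augmented model: for every initial time, every input $u$, every solution $\tilde x$ of the model and every solution $\hat x$ of the observer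 driven by $u$ and $\tilde y=\bar C\tilde x$ (with arbitrary initial data), $\hat x(t)-\tilde x(t)\to0$ as $t\to\infty$. -/

import Mathlib

open Matrix Filter Topology MeasureTheory

/-- A network of `N` TCP sources sharing one router, together with an operating (equilibrium)
point around which the fluid-flow model is linearized. -/
structure TCPNetwork (N : ℕ) where
  /-- link capacity -/
  c : ℝ
  /-- number of sessions established by each source -/
  η : Fin N → ℕ
  /-- propagation times -/
  Tp : Fin N → ℝ
  /-- equilibrium queue length -/
  b₀ : ℝ
  /-- equilibrium rates -/
  x₀ : Fin N → ℝ
  /-- forward delays (source to router) -/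
  τf : Fin N → ℝ
  /-- backward delays (router to source, via the receiver) -/
  τb : Fin N → ℝ
  c_pos : 0 < c
  Tp_nonneg : ∀ i, 0 ≤ Tp i
  b₀_nonneg : 0 ≤ b₀
  x₀_pos : ∀ i, 0 < x₀ i
  τf_pos : ∀ i, 0 < τf i
  τb_nonneg : ∀ i, 0 ≤ τb i
  /-- the round trip time at equilibrium is the sum of the forward and backward delays -/
  rtt_eq : ∀ i, τf i + τb i = Tp i + b₀ / c
  /-- the queue is at equilibrium -/
  flow_eq : ∑ i, (η i : ℝ) * x₀ i = c

/-- Index set of `(δx₁, …, δx_N, δb)`. -/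
abbrev PlantIdx (N : ℕ) : Type := Fin N ⊕ Unit

/-- Index set, with `N + 2` elements, of the augmented state `(δx₁, …, δx_N, δb, d)`. -/
abbrev StateIdx (N : ℕ) : Type := PlantIdx N ⊕ Unit

/-- The `m × nN` block row `[M₁ … M_N]`; column `(s, i)` is column `s` of the `i`-th block. -/
def blockRow {N : ℕ} {m n : Type*} (M : Fin N → Matrix m n ℝ) : Matrix m (n × Fin N) ℝ :=
  Matrix.of fun r p => M p.2 r p.1

namespace TCPNetwork

variable {N : ℕ} (net : TCPNetwork N)

/-- Round trip times at equilibrium. -/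
noncomputable def τ₀ (i : Fin N) : ℝ := net.Tp i + net.b₀ / net.c

/-- Dropping probabilities at equilibrium. -/
noncomputable def p₀ (i : Fin N) : ℝ := 2 / (2 + (net.x₀ i * net.τ₀ i) ^ 2)

noncomputable def a (i : Fin N) : ℝ :=
  -((1 - net.p₀ i) / (net.x₀ i * net.τ₀ i ^ 2)) - net.x₀ i * net.p₀ i / 2

noncomputable def h (i : Fin N) : ℝ := -(2 * (1 - net.p₀ i) / (net.c * net.τ₀ i ^ 3))

noncomputable def f (i : Fin N) : ℝ := -(net.x₀ i / (net.τ₀ i * net.c))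

noncomputable def e (i : Fin N) : ℝ := -(1 / net.τ₀ i ^ 2) - net.x₀ i ^ 2 / 2

/-- `A = [diag(a) h; 0 0]`. -/
noncomputable def A : Matrix (PlantIdx N) (PlantIdx N) ℝ :=
  Matrix.fromBlocks (Matrix.diagonal net.a) (Matrix.of fun i _ => net.h i) 0 0

/-- `A_d = [f ηᵀ 0; ηᵀ 0]`. -/
noncomputable def Ad : Matrix (PlantIdx N) (PlantIdx N) ℝ :=
  Matrix.fromBlocks (Matrix.of fun i j => net.f i * (net.η j : ℝ)) 0
    (Matrix.of fun _ j => (net.η j : ℝ)) 0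

/-- `B = [diag(e); 0]`. -/
noncomputable def B : Matrix (PlantIdx N) (Fin N) ℝ :=
  Matrix.fromRows (Matrix.diagonal net.e) 0

/-- `Ā = [A (0,…,0,1)ᵀ; 0 0]`. -/
noncomputable def Abar : Matrix (StateIdx N) (StateIdx N) ℝ :=
  Matrix.fromBlocks net.A (Matrix.fromRows 0 1) 0 0

/-- `Ā_d = [A_d 0; 0 0]`. -/
noncomputable def AdBar : Matrix (StateIdx N) (StateIdx N) ℝ :=
  Matrix.fromBlocks net.Ad 0 0 0

/-- `B̄ = [B; 0]`. -/
noncomputable def Bbar : Matrix (StateIdx N) (Fin N) ℝ :=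
  Matrix.fromRows net.B 0

/-- `Ā_{d_i}`: the only nonzero column is the `i`-th one, equal to `η_i (f₁, …, f_N, 1, 0)ᵀ`. -/
noncomputable def Adi (i : Fin N) : Matrix (StateIdx N) (StateIdx N) ℝ :=
  Matrix.of fun r s =>
    if s = Sum.inl (Sum.inl i) then
      (net.η i : ℝ) * Sum.elim (Sum.elim net.f (fun _ => 1)) (fun _ => 0) r
    else 0

end TCPNetwork

/-- The output matrix `C = [0 … 0 1]`, which measures the queue length. -/
def outC (N : ℕ) : Matrix Unit (PlantIdx N) ℝ := Matrix.fromCols 0 1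

/-- `C̄ = [C 0]`. -/
def outCbar (N : ℕ) : Matrix Unit (StateIdx N) ℝ := Matrix.fromCols (outC N) 0

/-- `(δx₁(t - τ₁), …, δx_N(t - τ_N), δb(t), d(t))`: only the rates are delayed, each by its own
delay. -/
def delayed {N : ℕ} (τ : Fin N → ℝ) (x : ℝ → StateIdx N → ℝ) (t : ℝ) : StateIdx N → ℝ :=
  Sum.elim
    (Sum.elim (fun i => x (t - τ i) (Sum.inl (Sum.inl i))) (fun k => x t (Sum.inl (Sum.inr k))))
    (fun k => x t (Sum.inr k))

/-- `x` is a solution, from the initial time `t₀` on, of `ẋ(t) = F t (x(t)) (x_d(t))`, in the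
sense of Carathéodory (integrated equation). The initial data are the value `x(t₀)` and, as the
`i`-th rate is the only component that enters with the delay `τ i`, a continuous history of that
rate on `[t₀ - τ i, t₀]`. -/
structure IsDelaySolution {N : ℕ} (τ : Fin N → ℝ) (t₀ : ℝ)
    (F : ℝ → (StateIdx N → ℝ) → (StateIdx N → ℝ) → (StateIdx N → ℝ))
    (x : ℝ → StateIdx N → ℝ) : Prop where
  history : ∀ i, ContinuousOn (fun t => x t (Sum.inl (Sum.inl i))) (Set.Ici (t₀ - τ i))
  continuousOn : ContinuousOn x (Set.Ici t₀)
  intervalIntegrable : ∀ t, t₀ ≤ t →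
    IntervalIntegrable (fun s => F s (x s) (delayed τ x s)) volume t₀ t
  eq_integral : ∀ t, t₀ ≤ t → x t = x t₀ + ∫ s in t₀..t, F s (x s) (delayed τ x s)

namespace TCPNetwork

variable {N : ℕ} (net : TCPNetwork N)

/-- `x` solves the augmented model `ẋ = Ā x + Ā_d x_d + B̄ u` from time `t₀` on. -/
def IsAugmentedTrajectory (t₀ : ℝ) (u : ℝ → Fin N → ℝ) (x : ℝ → StateIdx N → ℝ) : Prop :=
  IsDelaySolution net.τf t₀
    (fun t v vd => net.Abar *ᵥ v + net.AdBar *ᵥ vd + net.Bbar *ᵥ u t) x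

/-- `xhat` solves the observer equation `ẋ = Ā x + Ā_d x_d + B̄ u + L (y - C̄ x)`, with gain `L`,
input `u` and measured output `y`, from time `t₀` on. -/
def IsObserverTrajectory (L : Matrix (StateIdx N) Unit ℝ) (t₀ : ℝ) (u : ℝ → Fin N → ℝ)
    (y : ℝ → Unit → ℝ) (xhat : ℝ → StateIdx N → ℝ) : Prop :=
  IsDelaySolution net.τf t₀
    (fun t v vd => net.Abar *ᵥ v + net.AdBar *ᵥ vd + net.Bbar *ᵥ u t
      + L *ᵥ (y t - outCbar N *ᵥ v)) xhat

/-- The observer with gain `L` is an observer for the augmented model: for every initial time,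
every input and all initial data of the model and of the observer, the observer state driven by
the input and by the output `y = C̄ x` of the model converges to the state of the model. -/
def IsAsymptoticObserver (L : Matrix (StateIdx N) Unit ℝ) : Prop :=
  ∀ (t₀ : ℝ) (u : ℝ → Fin N → ℝ) (x xhat : ℝ → StateIdx N → ℝ),
    net.IsAugmentedTrajectory t₀ u x →
    net.IsObserverTrajectory L t₀ u (fun t => outCbar N *ᵥ x t) xhat →
    Tendsto (fun t => xhat t - x t) atTop (𝓝 0)

/-- `Ψ`. -/
noncomputable def Psi (P : Matrix (StateIdx N) (StateIdx N) ℝ)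
    (Q : Fin N → Matrix (StateIdx N) (StateIdx N) ℝ) (X : Matrix (StateIdx N) Unit ℝ) :
    Matrix (StateIdx N) (StateIdx N) ℝ :=
  -(P * net.Abar) - net.Abarᵀ * P + X * outCbar N + (outCbar N)ᵀ * Xᵀ - ∑ i, Q i

/-- `Ξ₁`. -/
noncomputable def Xi1 (P : Matrix (StateIdx N) (StateIdx N) ℝ)
    (Q : Fin N → Matrix (StateIdx N) (StateIdx N) ℝ) (X : Matrix (StateIdx N) Unit ℝ) :
    Matrix (StateIdx N ⊕ StateIdx N × Fin N) (StateIdx N ⊕ StateIdx N × Fin N) ℝ :=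
  Matrix.fromBlocks (net.Psi P Q X) (blockRow fun i => -(P * net.Adi i))
    (blockRow fun i => (-((net.Adi i)ᵀ * P))ᵀ)ᵀ (Matrix.blockDiagonal Q)

/-- `Y = [PĀ - XC̄  PĀ_{d_1} … PĀ_{d_N}]ᵀ`. -/
noncomputable def Y (P : Matrix (StateIdx N) (StateIdx N) ℝ) (X : Matrix (StateIdx N) Unit ℝ) :
    Matrix (StateIdx N ⊕ StateIdx N × Fin N) (StateIdx N) ℝ :=
  (Matrix.fromCols (P * net.Abar - X * outCbar N) (blockRow fun i => P * net.Adi i))ᵀ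

end TCPNetwork

/-- `M_i`: block column with `-1` in the first block, `1` in the block of the `i`-th delay and `0`
in the others. -/
def lmiM {N : ℕ} (i : Fin N) :
    Matrix (StateIdx N ⊕ StateIdx N × Fin N) (StateIdx N) ℝ :=
  (Matrix.fromCols (-1) (blockRow fun j => if j = i then 1 else 0))ᵀ

/-- `Ξ₃ = ∑ M_i (2P - S_i) M_iᵀ`. -/
noncomputable def lmiXi3 {N : ℕ} (P : Matrix (StateIdx N) (StateIdx N) ℝ)
    (S : Fin N → Matrix (StateIdx N) (StateIdx N) ℝ) :
    Matrix (StateIdx N ⊕ StateIdx N × Fin N) (StateIdx N ⊕ StateIdx N × Fin N) ℝ :=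
  ∑ i, lmiM i * ((2 : ℝ) • P - S i) * (lmiM i)ᵀ

/-- The block matrix of the linear matrix inequality,
`[Ξ₁ + Ξ₃, Y … Y; (Y … Y)ᵀ, diag((τ_i^f)⁻² S_i)]`. -/
noncomputable def TCPNetwork.lmiMatrix {N : ℕ} (net : TCPNetwork N)
    (P : Matrix (StateIdx N) (StateIdx N) ℝ)
    (Q S : Fin N → Matrix (StateIdx N) (StateIdx N) ℝ) (X : Matrix (StateIdx N) Unit ℝ) :
    Matrix ((StateIdx N ⊕ StateIdx N × Fin N) ⊕ StateIdx N × Fin N)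
      ((StateIdx N ⊕ StateIdx N × Fin N) ⊕ StateIdx N × Fin N) ℝ :=
  Matrix.fromBlocks (net.Xi1 P Q X + lmiXi3 P S) (blockRow fun _ => net.Y P X)
    (blockRow fun _ => net.Y P X)ᵀ
    (Matrix.blockDiagonal fun i => (1 / net.τf i ^ 2) • S i)

/-! ### Derivatives, antiderivatives and monotonicity on open half-lines. -/

section Calculus

/-! The input cancels in the error `e = xhat - x`, which solves `ė = K e + ∑ A_i e(t - τ_i)` with `K
= Ā - L C̄` and `A_i = Ā_{d_i}`. Its decay comes from the Lyapunov–Krasovskii functional `V = eᵀPe +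
∑ ∫_{t-τ_i}^t eᵀQ_i e + ∑ τ_i ∫_{t-τ_i}^t (s - t + τ_i) rᵀS_i⁻¹r ds`, `r = P ė`. In `V'` the last
sum gives `τ_i² rᵀS_i⁻¹r - τ_i ∫ rᵀS_i⁻¹r`; `jensen_delay` bounds the integral below by a form in
`e(t - τ_i) - e(t)` with matrix `2P - S_i`. What remains is a quadratic form in `e` and the delayed
errors, bounded by a Schur complement of the LMI (`exists_quadratic_form_le`), whence `V' ≤ -ε (|e|²
+ ∑ |e(t - τ_i)|²)`. As `V ≥ 0`, the error and its delays are square integrable, hence so is `ė`.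
Each `e_k²` is then integrable with integrable derivative, so it tends to `0`
(`tendsto_zero_of_integrableOn_sq`). All integrals are increments of antiderivatives, so the
estimates reduce to monotonicity. -/

theorem HasDerivAt.dotProduct {n : Type*} [Fintype n] {u v : ℝ → n → ℝ} {u' v' : n → ℝ} {t : ℝ}
    (hu : HasDerivAt u u' t) (hv : HasDerivAt v v' t) :
    HasDerivAt (fun s => u s ⬝ᵥ v s) (u' ⬝ᵥ v t + u t ⬝ᵥ v') t := by
  simp only [_root_.dotProduct, ← Finset.sum_add_distrib]
  exact HasDerivAt.fun_sum fun k _ => (hasDerivAt_pi.1 hu k).mul (hasDerivAt_pi.1 hv k)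

theorem HasDerivAt.mulVec {m n : Type*} [Fintype m] [Fintype n] (M : Matrix m n ℝ)
    {u : ℝ → n → ℝ} {u' : n → ℝ} {t : ℝ} (hu : HasDerivAt u u' t) :
    HasDerivAt (fun s => M *ᵥ u s) (M *ᵥ u') t :=
  (LinearMap.toContinuousLinearMap M.mulVecLin).hasFDerivAt.comp_hasDerivAt t hu

theorem ContinuousOn.dotProduct {n : Type*} [Fintype n] {u v : ℝ → n → ℝ} {s : Set ℝ}
    (hu : ContinuousOn u s) (hv : ContinuousOn v s) :
    ContinuousOn (fun t => u t ⬝ᵥ v t) s := by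
  simp only [_root_.dotProduct]
  exact continuousOn_finsetSum _ fun k _ =>
    (continuousOn_pi.1 hu k).mul (continuousOn_pi.1 hv k)

theorem ContinuousOn.matrix_mulVec {m n : Type*} [Fintype m] [Fintype n] (M : Matrix m n ℝ)
    {u : ℝ → n → ℝ} {s : Set ℝ} (hu : ContinuousOn u s) :
    ContinuousOn (fun t => M *ᵥ u t) s :=
  (LinearMap.toContinuousLinearMap M.mulVecLin).continuous.comp_continuousOn hu

theorem exists_hasDerivAt_of_continuousOn_Ioi {q : ℝ → ℝ} {a : ℝ}
    (hq : ContinuousOn q (Set.Ioi a)) : ∃ G : ℝ → ℝ, ∀ t, a < t → HasDerivAt G (q t) t := by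
  -- The base point is interior because `q` need not be integrable near `a`.
  refine ⟨fun t => ∫ s in (a + 1)..t, q s, fun t ht => ?_⟩
  have hsub : Set.uIcc (a + 1) t ⊆ Set.Ioi a := fun s hs =>
    lt_of_lt_of_le (lt_min (by linarith) ht) hs.1
  exact intervalIntegral.integral_hasDerivAt_right (hq.mono hsub).intervalIntegrable
    (hq.stronglyMeasurableAtFilter isOpen_Ioi t ht) (hq.continuousAt (Ioi_mem_nhds ht))

theorem monotoneOn_Ioi_of_hasDerivAt_nonneg {f f' : ℝ → ℝ} {a : ℝ}
    (hf : ∀ t, a < t → HasDerivAt f (f' t) t) (hf' : ∀ t, a < t → 0 ≤ f' t) :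
    MonotoneOn f (Set.Ioi a) := by
  refine monotoneOn_of_hasDerivWithinAt_nonneg (f' := f') (convex_Ioi a)
    (fun t ht => (hf t ht).continuousAt.continuousWithinAt) ?_ ?_ <;> rw [interior_Ioi]
  · exact fun t ht => (hf t ht).hasDerivWithinAt
  · exact hf'

theorem HasDerivAt.comp_sub_const' {f : ℝ → ℝ} {f' t τ : ℝ} (hf : HasDerivAt f f' (t - τ)) :
    HasDerivAt (fun s => f (s - τ)) f' t :=
  HasDerivAt.comp_sub_const t τ hf

/-- A nonnegative function dominated by the decay rate of a nonnegative function is integrable. -/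
theorem integrableOn_Ioi_of_le_neg_deriv {V V' g : ℝ → ℝ} {a b : ℝ} (hab : a < b)
    (hV : ∀ t, a < t → HasDerivAt V (V' t) t) (hV0 : ∀ t, a < t → 0 ≤ V t)
    (hg : ContinuousOn g (Set.Ioi a)) (hg0 : ∀ t, a < t → 0 ≤ g t)
    (hle : ∀ t, a < t → V' t ≤ -g t) : IntegrableOn g (Set.Ioi b) := by
  obtain ⟨G, hG⟩ := exists_hasDerivAt_of_continuousOn_Ioi hg
  have hmono := monotoneOn_Ioi_of_hasDerivAt_nonneg hG hg0
  -- `G + V` decreases and `V ≥ 0`, so the increasing function `G` is bounded and has a limit.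
  have hsum := monotoneOn_Ioi_of_hasDerivAt_nonneg (f := fun t => -(G t + V t))
    (fun t ht => ((hG t ht).add (hV t ht)).neg) (fun t ht => by linarith [hle t ht])
  have hbd : ∀ t, b ≤ t → G t ≤ G b + V b := fun t ht => by
    have := hsum (show a < b from hab) (show a < t by linarith) ht
    simp only at this
    linarith [hV0 t (by linarith)]
  have hmono' : Monotone fun t => G (max b t) := fun s t hst =>
    hmono (lt_max_of_lt_left hab) (lt_max_of_lt_left hab) (max_le_max le_rfl hst)
  have hlim : Tendsto (fun t => G (max b t)) atTop (𝓝 (⨆ t, G (max b t))) :=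
    tendsto_atTop_ciSup hmono' ⟨G b + V b, by rintro _ ⟨t, rfl⟩; exact hbd _ (le_max_left _ _)⟩
  refine integrableOn_Ioi_deriv_of_nonneg (g := G)
    (hG b hab).continuousAt.continuousWithinAt (fun t ht => hG t (hab.trans ht))
    (fun t ht => hg0 t (hab.trans ht)) (hlim.congr' ?_)
  filter_upwards [eventually_ge_atTop b] with t ht
  rw [max_eq_right ht]

end Calculus

/-! ### Positive definite quadratic forms. -/

section PosDef

variable {n : Type*} [Fintype n]

theorem Matrix.PosDef.real_pos {M : Matrix n n ℝ} (hM : M.PosDef) {v : n → ℝ} (hv : v ≠ 0) :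
    0 < v ⬝ᵥ M *ᵥ v := by
  simpa using hM.dotProduct_mulVec_pos hv

theorem Matrix.PosDef.real_nonneg {M : Matrix n n ℝ} (hM : M.PosDef) (v : n → ℝ) :
    0 ≤ v ⬝ᵥ M *ᵥ v := by
  simpa using hM.posSemidef.dotProduct_mulVec_nonneg v

theorem Matrix.PosDef.real_symm {M : Matrix n n ℝ} (hM : M.PosDef) (u v : n → ℝ) :
    u ⬝ᵥ M *ᵥ v = v ⬝ᵥ M *ᵥ u := by
  have h : Mᵀ = M := by simpa using hM.isHermitian.eq
  conv_lhs => rw [← h]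
  rw [dotProduct_transpose_mulVec]

/-- The Rayleigh quotient attains a positive minimum on the compact unit sphere. The sphere is that
of the sup norm, which is harmless since the quotient has degree `0`; it is empty when `n` is. -/
theorem Matrix.PosDef.exists_coercive {M : Matrix n n ℝ} (hM : M.PosDef) :
    ∃ ε > 0, ∀ v : n → ℝ, ε * (v ⬝ᵥ v) ≤ v ⬝ᵥ M *ᵥ v := by
  have hdot : ∀ v : n → ℝ, v ≠ 0 → 0 < v ⬝ᵥ v := fun v hv => by
    simpa using dotProduct_star_self_pos_iff.2 hv
  by_cases hne : (Metric.sphere (0 : n → ℝ) 1).Nonempty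
  · have hz : ∀ x ∈ Metric.sphere (0 : n → ℝ) 1, x ≠ 0 := fun x hx h => by simp [h] at hx
    have hcont : ContinuousOn (fun v : n → ℝ => (v ⬝ᵥ M *ᵥ v) / (v ⬝ᵥ v))
        (Metric.sphere (0 : n → ℝ) 1) :=
      ContinuousOn.div
        (continuous_id.dotProduct (continuous_const.matrix_mulVec continuous_id)).continuousOn
        (continuous_id.dotProduct continuous_id).continuousOn (fun x hx => (hdot x (hz x hx)).ne')
    obtain ⟨x, hx, hmin⟩ := (isCompact_sphere (0 : n → ℝ) 1).exists_isMinOn hne hcont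
    refine ⟨_, div_pos (hM.real_pos (hz x hx)) (hdot x (hz x hx)), fun v => ?_⟩
    rcases eq_or_ne v 0 with rfl | hv
    · simp
    have hn : ‖v‖ ≠ 0 := norm_ne_zero_iff.2 hv
    have hy : ‖v‖⁻¹ • v ∈ Metric.sphere (0 : n → ℝ) 1 := by
      simp [norm_smul, hn]
    have := hmin hy
    simp only [Set.mem_ofPred_eq, mulVec_smul, smul_dotProduct,
      dotProduct_smul, smul_eq_mul] at this
    rw [mul_div_mul_left _ _ (inv_ne_zero hn), mul_div_mul_left _ _ (inv_ne_zero hn)] at this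
    exact (le_div_iff₀ (hdot v hv)).1 this
  · refine ⟨1, one_pos, fun v => ?_⟩
    have hv : v = 0 := by
      by_contra hv
      exact hne ⟨‖v‖⁻¹ • v, by simp [norm_smul, norm_ne_zero_iff.2 hv]⟩
    simp [hv]

variable [DecidableEq n]

theorem Matrix.PosDef.mulVec_inv_mulVec {S : Matrix n n ℝ} (hS : S.PosDef) (r : n → ℝ) :
    S *ᵥ (S⁻¹ *ᵥ r) = r := by
  rw [mulVec_mulVec, mul_nonsing_inv _ ((isUnit_iff_isUnit_det S).1 hS.isUnit), one_mulVec]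

/-- Fenchel's inequality for a positive definite quadratic form. -/
theorem Matrix.PosDef.fenchel {S : Matrix n n ℝ} (hS : S.PosDef) (r v : n → ℝ) :
    2 * (v ⬝ᵥ r) ≤ r ⬝ᵥ S⁻¹ *ᵥ r + v ⬝ᵥ S *ᵥ v := by
  have h := hS.real_nonneg (S⁻¹ *ᵥ r - v)
  rw [mulVec_sub, hS.mulVec_inv_mulVec, sub_dotProduct, dotProduct_sub, dotProduct_sub,
    hS.real_symm _ v, hS.mulVec_inv_mulVec, dotProduct_comm _ r] at h
  linarith

end PosDef

/-! ### Delay-dependent stability of linear systems. -/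

section Stability

variable {n : Type*} [Fintype n]

/-- Jensen's inequality for the integral term of the Lyapunov–Krasovskii functional. Here `H` is an
antiderivative of `(P ẋ)ᵀ S⁻¹ (P ẋ)`. -/
theorem jensen_delay [DecidableEq n] {P S : Matrix n n ℝ} (hS : S.PosDef) {a τ t : ℝ}
    (hτ : 0 < τ) (ht : a < t - τ) {x w : ℝ → n → ℝ} {H : ℝ → ℝ}
    (hx : ∀ s, a < s → HasDerivAt x (w s) s)
    (hH : ∀ s, a < s → HasDerivAt H ((P *ᵥ w s) ⬝ᵥ S⁻¹ *ᵥ (P *ᵥ w s)) s) :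
    (x (t - τ) - x t) ⬝ᵥ ((2 : ℝ) • P - S) *ᵥ (x (t - τ) - x t) ≤ τ * (H t - H (t - τ)) := by
  -- The mean velocity. Using it in Fenchel's inequality yields the matrix `2P - S`, linear in the
  -- unknowns, in place of `P S⁻¹ P`.
  set v : n → ℝ := τ⁻¹ • (x t - x (t - τ)) with hv
  have hmono := monotoneOn_Ioi_of_hasDerivAt_nonneg
    (f := fun s => H s - 2 * (v ⬝ᵥ P *ᵥ x s) + s * (v ⬝ᵥ S *ᵥ v)) (a := a)
    (fun s hs => ((hH s hs).sub
      (((hasDerivAt_const s v).dotProduct ((hx s hs).mulVec P)).const_mul 2)).add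
      ((hasDerivAt_id s).mul_const _))
    (fun s hs => by
      have := hS.fenchel (P *ᵥ w s) v
      simp only [zero_dotProduct, zero_add, one_mul]
      linarith)
  have h := hmono (show a < t - τ from ht) (show a < t by linarith) (by linarith)
  have hd : x (t - τ) - x t = (-τ) • v := by
    rw [hv, smul_smul, neg_mul, mul_inv_cancel₀ hτ.ne', neg_one_smul, neg_sub]
  have hd' : x t = x (t - τ) + τ • v := by
    rw [hv, smul_smul, mul_inv_cancel₀ hτ.ne', one_smul, add_sub_cancel]
  have hP : v ⬝ᵥ P *ᵥ x t = v ⬝ᵥ P *ᵥ x (t - τ) + τ * (v ⬝ᵥ P *ᵥ v) := by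
    conv_lhs => rw [hd', mulVec_add, dotProduct_add, mulVec_smul, dotProduct_smul, smul_eq_mul]
  rw [hd]
  simp only [sub_mulVec, smul_mulVec, mulVec_smul, smul_dotProduct, dotProduct_smul,
    dotProduct_sub, smul_eq_mul]
  simp only [hP] at h
  nlinarith [mul_le_mul_of_nonneg_left h hτ.le]

variable {ι : Type*} [Fintype ι]

/-- A Barbalat-type argument: the equation puts `w` in `L²` along with `x` and the `z i`, so `x_k²`
and its derivative `2 x_k w_k` are integrable. -/
theorem tendsto_zero_of_integrableOn_sq {a : ℝ} {x w : ℝ → n → ℝ} {z : ι → ℝ → n → ℝ}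
    (K : Matrix n n ℝ) (A : ι → Matrix n n ℝ)
    (hx : ∀ t, a < t → HasDerivAt x (w t) t) (hz : ∀ i, ContinuousOn (z i) (Set.Ioi a))
    (hw : ∀ t, a < t → w t = K *ᵥ x t + ∑ i, A i *ᵥ z i t)
    (hint : IntegrableOn (fun t => x t ⬝ᵥ x t + ∑ i, z i t ⬝ᵥ z i t) (Set.Ioi a)) :
    Tendsto x atTop (𝓝 0) := by
  have hxc : ContinuousOn x (Set.Ioi a) := fun t ht => (hx t ht).continuousAt.continuousWithinAt
  have hmem : ∀ f : ℝ → ℝ, ContinuousOn f (Set.Ioi a) →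
      (∀ t, f t ^ 2 ≤ x t ⬝ᵥ x t + ∑ i, z i t ⬝ᵥ z i t) →
      MemLp f 2 (volume.restrict (Set.Ioi a)) := fun f hf hle => by
    refine (memLp_two_iff_integrable_sq (hf.aestronglyMeasurable measurableSet_Ioi)).2 ?_
    refine hint.mono' ((hf.pow 2).aestronglyMeasurable measurableSet_Ioi)
      (Eventually.of_forall fun t => ?_)
    rw [Real.norm_of_nonneg (sq_nonneg _)]
    exact hle t
  have hself : ∀ v : n → ℝ, 0 ≤ v ⬝ᵥ v := fun v => Finset.sum_nonneg fun k _ => mul_self_nonneg _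
  have hle : ∀ (v : n → ℝ) k, v k ^ 2 ≤ v ⬝ᵥ v := fun v k => by
    rw [sq]
    exact Finset.single_le_sum (f := fun k => v k * v k) (fun k _ => mul_self_nonneg _)
      (Finset.mem_univ k)
  have hxm : ∀ k, MemLp (fun t => x t k) 2 (volume.restrict (Set.Ioi a)) := fun k =>
    hmem _ (continuousOn_pi.1 hxc k) fun t => by
      linarith [hle (x t) k, Finset.sum_nonneg fun i (_ : i ∈ Finset.univ) => hself (z i t)]
  have hzm : ∀ i k, MemLp (fun t => z i t k) 2 (volume.restrict (Set.Ioi a)) := fun i k =>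
    hmem _ (continuousOn_pi.1 (hz i) k) fun t => by
      linarith [hle (z i t) k, hself (x t), Finset.single_le_sum (f := fun i => z i t ⬝ᵥ z i t)
        (fun i _ => hself (z i t)) (Finset.mem_univ i)]
  have hwm : ∀ k, MemLp (fun t => (K *ᵥ x t + ∑ i, A i *ᵥ z i t) k) 2
      (volume.restrict (Set.Ioi a)) := fun k => by
    simp only [Pi.add_apply, Finset.sum_apply, mulVec, dotProduct]
    exact (memLp_finsetSum _ fun l _ => (hxm l).const_mul _).add
      (memLp_finsetSum _ fun i _ => memLp_finsetSum _ fun l _ => (hzm i l).const_mul _)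
  rw [tendsto_pi_nhds]
  intro k
  have hlim : Tendsto (fun t => x t k * x t k) atTop (𝓝 0) := by
    refine tendsto_zero_of_hasDerivAt_of_integrableOn_Ioi (a := a)
      (f' := fun t => (K *ᵥ x t + ∑ i, A i *ᵥ z i t) k * x t k +
        x t k * (K *ᵥ x t + ∑ i, A i *ᵥ z i t) k) (fun t ht => ?_)
      (((hwm k).integrable_mul (hxm k)).add ((hxm k).integrable_mul (hwm k)))
      ((hxm k).integrable_mul (hxm k))
    have := hasDerivAt_pi.1 (hx t ht) k
    rw [hw t ht] at this
    exact this.mul this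
  have h := hlim.sqrt
  simp only [Real.sqrt_mul_self_eq_abs, Real.sqrt_zero] at h
  exact (tendsto_zero_iff_abs_tendsto_zero _).2 h

/-- Delay-dependent stability of `ẋ(t) = K x(t) + ∑ A_i x(t - τ_i)` from a quadratic form
inequality, by means of a Lyapunov–Krasovskii functional. -/
theorem delay_stable_of_quadratic_form [DecidableEq n] {τ : ι → ℝ} (hτ : ∀ i, 0 < τ i)
    {P K : Matrix n n ℝ}
    {A Q S : ι → Matrix n n ℝ} (hP : P.PosDef) (hQ : ∀ i, (Q i).PosDef) (hS : ∀ i, (S i).PosDef)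
    {ε : ℝ} (hε : 0 < ε)
    (hform : ∀ (e : n → ℝ) (z : ι → n → ℝ) (r : n → ℝ), r = P *ᵥ (K *ᵥ e + ∑ i, A i *ᵥ z i) →
      ε * (e ⬝ᵥ e + ∑ i, z i ⬝ᵥ z i) ≤ -(2 * (e ⬝ᵥ r)) - ∑ i, e ⬝ᵥ Q i *ᵥ e
        + ∑ i, z i ⬝ᵥ Q i *ᵥ z i + ∑ i, (z i - e) ⬝ᵥ ((2 : ℝ) • P - S i) *ᵥ (z i - e)
        - ∑ i, τ i ^ 2 * (r ⬝ᵥ (S i)⁻¹ *ᵥ r))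
    {t₀ : ℝ} {x w : ℝ → n → ℝ} (hx : ∀ t, t₀ < t → HasDerivAt x (w t) t)
    (hwc : ContinuousOn w (Set.Ioi t₀))
    (hw : ∀ t, t₀ < t → w t = K *ᵥ x t + ∑ i, A i *ᵥ x (t - τ i)) :
    Tendsto x atTop (𝓝 0) := by
  have hxc : ContinuousOn x (Set.Ioi t₀) := fun t ht => (hx t ht).continuousAt.continuousWithinAt
  choose G hG using fun i => exists_hasDerivAt_of_continuousOn_Ioi
    (hxc.dotProduct (hxc.matrix_mulVec (Q i)))
  choose H hH using fun i => exists_hasDerivAt_of_continuousOn_Ioi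
    ((hwc.matrix_mulVec P).dotProduct ((hwc.matrix_mulVec P).matrix_mulVec (S i)⁻¹))
  choose J hJ using fun i => exists_hasDerivAt_of_continuousOn_Ioi (q := H i) (a := t₀)
    (fun t ht => (hH i t ht).continuousAt.continuousWithinAt)
  -- Beyond `T` every delayed time exceeds `t₀`, where `x` is differentiable.
  set T : ℝ := t₀ + ∑ i, τ i
  have hTi : ∀ i t, T < t → t₀ < t - τ i := fun i t ht => by
    linarith [Finset.single_le_sum (f := τ) (fun i _ => (hτ i).le) (Finset.mem_univ i)]
  have hT0 : ∀ t, T < t → t₀ < t := fun t ht => by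
    linarith [Finset.sum_nonneg fun i (_ : i ∈ Finset.univ) => (hτ i).le]
  have hself : ∀ v : n → ℝ, 0 ≤ v ⬝ᵥ v := fun v => Finset.sum_nonneg fun k _ => mul_self_nonneg _
  have hzc : ∀ i, ContinuousOn (fun t => x (t - τ i)) (Set.Ioi T) := fun i =>
    hxc.comp (continuous_sub_right _).continuousOn fun t ht => hTi i t ht
  have hxT : ContinuousOn x (Set.Ioi T) := hxc.mono fun t ht => hT0 t ht
  have hGmono := fun i => monotoneOn_Ioi_of_hasDerivAt_nonneg (hG i)
    fun t _ => (hQ i).real_nonneg (x t)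
  have hHmono := fun i => monotoneOn_Ioi_of_hasDerivAt_nonneg (hH i)
    fun t _ => (hS i).inv.real_nonneg (P *ᵥ w t)
  have hgint : IntegrableOn (fun t => ε * (x t ⬝ᵥ x t + ∑ i, x (t - τ i) ⬝ᵥ x (t - τ i)))
      (Set.Ioi (T + 1)) := by
    refine integrableOn_Ioi_of_le_neg_deriv (a := T) (by linarith)
      -- The last sum is `τ_i ∫_{t-τ_i}^t (H_i(t) - H_i(s)) ds`, the weighted integral of `rᵀS_i⁻¹r`
      -- after exchanging the order of integration.
      (V := fun t => x t ⬝ᵥ P *ᵥ x t + ∑ i, (G i t - G i (t - τ i)) +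
        ∑ i, τ i * (τ i * H i t - (J i t - J i (t - τ i))))
      (fun t ht => (((hx t (hT0 t ht)).dotProduct ((hx t (hT0 t ht)).mulVec P)).add
        (HasDerivAt.fun_sum fun i _ => (hG i t (hT0 t ht)).sub
          (hG i _ (hTi i t ht)).comp_sub_const')).add
        (HasDerivAt.fun_sum fun i _ => (((hH i t (hT0 t ht)).const_mul (τ i)).sub
          ((hJ i t (hT0 t ht)).sub (hJ i _ (hTi i t ht)).comp_sub_const')).const_mul (τ i)))
      (fun t ht => ?_) ?_ (fun t _ => ?_) (fun t ht => ?_)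
    · refine add_nonneg (add_nonneg (hP.real_nonneg _) (Finset.sum_nonneg fun i _ => ?_))
        (Finset.sum_nonneg fun i _ => mul_nonneg (hτ i).le ?_)
      · exact sub_nonneg.2 (hGmono i (hTi i t ht) (hT0 t ht) (by linarith [hτ i]))
      -- The mean of the increasing function `H i` over `[t - τ i, t]` is a value `H i c ≤ H i t`.
      · obtain ⟨c, hc, hslope⟩ := exists_hasDerivAt_eq_slope (J i) (H i)
          (show t - τ i < t by linarith [hτ i])
          (fun s hs => (hJ i s ((hTi i t ht).trans_le hs.1)).continuousAt.continuousWithinAt)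
          (fun s hs => hJ i s ((hTi i t ht).trans hs.1))
        have hle := hHmono i ((hTi i t ht).trans hc.1) (hT0 t ht) hc.2.le
        rw [hslope, sub_sub_cancel, div_le_iff₀ (hτ i)] at hle
        linarith
    · exact continuousOn_const.mul ((hxT.dotProduct hxT).add
        (continuousOn_finsetSum _ fun i _ => (hzc i).dotProduct (hzc i)))
    · exact mul_nonneg hε.le (add_nonneg (hself _) (Finset.sum_nonneg fun i _ => hself _))
    · have h1 := hform (x t) (fun i => x (t - τ i)) (P *ᵥ w t) (by rw [hw t (hT0 t ht)])
      have h2 := Finset.sum_le_sum fun i (_ : i ∈ Finset.univ) =>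
        jensen_delay (hS i) (hτ i) (hTi i t ht) hx (hH i)
      have h3 := hP.real_symm (w t) (x t)
      simp only [mul_sub, Finset.sum_sub_distrib, ← mul_assoc, ← sq] at h1 h2 ⊢
      linarith
  refine tendsto_zero_of_integrableOn_sq (a := T + 1) K A
    (z := fun i t => x (t - τ i)) (fun t ht => hx t (hT0 t (by linarith)))
    (fun i => (hzc i).mono (Set.Ioi_subset_Ioi (by linarith)))
    (fun t ht => hw t (hT0 t (by linarith))) ?_
  simpa [IntegrableOn, hε.ne'] using hgint.const_mul ε⁻¹

end Stability

/-! ### Block vectors and block matrices. -/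

section Blocks

variable {N : ℕ} {m n : Type*} [Fintype n]

theorem blockRow_mulVec (M : Fin N → Matrix m n ℝ) (y : Fin N → n → ℝ) :
    blockRow M *ᵥ (fun p => y p.2 p.1) = ∑ i, M i *ᵥ y i := by
  ext r
  simp only [blockRow, mulVec, dotProduct, of_apply, Finset.sum_apply, Fintype.sum_prod_type]
  exact Finset.sum_comm

theorem dotProduct_curry (u v : Fin N → n → ℝ) :
    (fun p : n × Fin N => u p.2 p.1) ⬝ᵥ (fun p => v p.2 p.1) = ∑ i, u i ⬝ᵥ v i := by
  simp only [dotProduct, Fintype.sum_prod_type]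
  exact Finset.sum_comm

theorem blockDiagonal_mulVec (M : Fin N → Matrix n n ℝ) (y : Fin N → n → ℝ) :
    blockDiagonal M *ᵥ (fun p => y p.2 p.1) = fun p => (M p.2 *ᵥ y p.2) p.1 := by
  ext ⟨r, i⟩
  simp [mulVec, dotProduct, blockDiagonal_apply, Fintype.sum_prod_type]

theorem dotProduct_blockDiagonal_mulVec (M : Fin N → Matrix n n ℝ) (y : Fin N → n → ℝ) :
    (fun p : n × Fin N => y p.2 p.1) ⬝ᵥ blockDiagonal M *ᵥ (fun p => y p.2 p.1) =
      ∑ i, y i ⬝ᵥ M i *ᵥ y i := by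
  rw [blockDiagonal_mulVec]
  exact dotProduct_curry y fun i => M i *ᵥ y i

theorem dotProduct_transpose_mulVec' [Fintype m] (M : Matrix m n ℝ) (u : n → ℝ) (v : m → ℝ) :
    u ⬝ᵥ Mᵀ *ᵥ v = (M *ᵥ u) ⬝ᵥ v := by
  rw [dotProduct_transpose_mulVec, dotProduct_comm]

/-- The vector whose blocks are `e, z₁, …, z_N`. -/
def stackVec {k : Type*} (e : k → ℝ) (z : Fin N → n → ℝ) : k ⊕ n × Fin N → ℝ :=
  Sum.elim e fun p => z p.2 p.1

end Blocks

/-! ### The quadratic form of the LMI. -/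

section QuadraticForm

variable {N : ℕ} (net : TCPNetwork N) {P : Matrix (StateIdx N) (StateIdx N) ℝ}
  (Q S : Fin N → Matrix (StateIdx N) (StateIdx N) ℝ) (X : Matrix (StateIdx N) Unit ℝ)

theorem Y_transpose_mulVec (e : StateIdx N → ℝ) (z : Fin N → StateIdx N → ℝ) :
    (net.Y P X)ᵀ *ᵥ stackVec e z =
      (P * net.Abar - X * outCbar N) *ᵥ e + ∑ i, (P * net.Adi i) *ᵥ z i := by
  rw [TCPNetwork.Y, transpose_transpose, stackVec, fromCols_mulVec_sumElim, blockRow_mulVec]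

theorem lmiM_transpose_mulVec (i : Fin N) (e : StateIdx N → ℝ) (z : Fin N → StateIdx N → ℝ) :
    (lmiM i)ᵀ *ᵥ stackVec e z = z i - e := by
  rw [lmiM, transpose_transpose, stackVec, fromCols_mulVec_sumElim, blockRow_mulVec,
    Finset.sum_eq_single i (fun j _ hj => by simp [hj]) (by simp)]
  simp [neg_mulVec, sub_eq_neg_add]

theorem dotProduct_lmiXi3_mulVec (e : StateIdx N → ℝ) (z : Fin N → StateIdx N → ℝ) :
    stackVec e z ⬝ᵥ lmiXi3 P S *ᵥ stackVec e z =
      ∑ i, (z i - e) ⬝ᵥ ((2 : ℝ) • P - S i) *ᵥ (z i - e) := by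
  rw [lmiXi3, sum_mulVec, dotProduct_sum]
  refine Finset.sum_congr rfl fun i _ => ?_
  rw [← mulVec_mulVec, ← mulVec_mulVec, lmiM_transpose_mulVec, ← lmiM_transpose_mulVec i e z,
    ← dotProduct_transpose_mulVec', transpose_transpose]

/-- By symmetry of `P`, the blocks of `Ξ₁` other than those with `Q i` come in transposed pairs and
add up to `-2 eᵀr`, with `r = Yᵀ (e, z)`. -/
theorem dotProduct_Xi1_mulVec (hP : P.PosDef) (e : StateIdx N → ℝ) (z : Fin N → StateIdx N → ℝ) :
    stackVec e z ⬝ᵥ net.Xi1 P Q X *ᵥ stackVec e z =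
      -(2 * (e ⬝ᵥ (net.Y P X)ᵀ *ᵥ stackVec e z)) - ∑ i, e ⬝ᵥ Q i *ᵥ e
        + ∑ i, z i ⬝ᵥ Q i *ᵥ z i := by
  have hPt : Pᵀ = P := by simpa using hP.isHermitian.eq
  have hA : e ⬝ᵥ ((net.Abar)ᵀ * P) *ᵥ e = e ⬝ᵥ (P * net.Abar) *ᵥ e := by
    rw [← dotProduct_transpose_mulVec (P * net.Abar), transpose_mul, hPt]
  have hX : e ⬝ᵥ ((outCbar N)ᵀ * Xᵀ) *ᵥ e = e ⬝ᵥ (X * outCbar N) *ᵥ e := by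
    rw [← dotProduct_transpose_mulVec (X * outCbar N), transpose_mul]
  have hAd : ∀ i, (-((net.Adi i)ᵀ * P))ᵀ = -(P * net.Adi i) := fun i => by
    rw [transpose_neg, transpose_mul, transpose_transpose, hPt]
  rw [Y_transpose_mulVec, TCPNetwork.Xi1, stackVec, fromBlocks_mulVec,
    sumElim_dotProduct_sumElim]
  simp only [Sum.elim_comp_inl, Sum.elim_comp_inr, dotProduct_add, hAd,
    dotProduct_transpose_mulVec', blockRow_mulVec, dotProduct_blockDiagonal_mulVec]
  rw [dotProduct_comm _ e]
  simp only [TCPNetwork.Psi, add_mulVec, sub_mulVec, neg_mulVec, dotProduct_add, dotProduct_sub,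
    dotProduct_neg, sum_mulVec, dotProduct_sum, hA, hX, Finset.sum_neg_distrib]
  ring

theorem dotProduct_lmiMatrix_mulVec (hP : P.PosDef) (e : StateIdx N → ℝ)
    (z y : Fin N → StateIdx N → ℝ) :
    stackVec (stackVec e z) y ⬝ᵥ net.lmiMatrix P Q S X *ᵥ stackVec (stackVec e z) y =
      -(2 * (e ⬝ᵥ (net.Y P X)ᵀ *ᵥ stackVec e z)) - ∑ i, e ⬝ᵥ Q i *ᵥ e
        + ∑ i, z i ⬝ᵥ Q i *ᵥ z i + ∑ i, (z i - e) ⬝ᵥ ((2 : ℝ) • P - S i) *ᵥ (z i - e)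
        + 2 * ∑ i, y i ⬝ᵥ (net.Y P X)ᵀ *ᵥ stackVec e z
        + ∑ i, 1 / net.τf i ^ 2 * (y i ⬝ᵥ S i *ᵥ y i) := by
  rw [TCPNetwork.lmiMatrix, stackVec, fromBlocks_mulVec, sumElim_dotProduct_sumElim]
  simp only [Sum.elim_comp_inl, Sum.elim_comp_inr, dotProduct_add, add_mulVec,
    dotProduct_transpose_mulVec', blockRow_mulVec, dotProduct_blockDiagonal_mulVec,
    dotProduct_Xi1_mulVec net Q X hP, dotProduct_lmiXi3_mulVec]
  simp only [dotProduct_sum, sum_dotProduct, smul_mulVec, dotProduct_smul, smul_eq_mul,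
    dotProduct_comm (stackVec e z) (net.Y P X *ᵥ _)]
  ring

variable {Q S X} in
/-- The quadratic form inequality obtained from the linear matrix inequality by taking the Schur
complement of the block `diag((τ_i^f)⁻² S_i)`. -/
theorem exists_quadratic_form_le (hP : P.PosDef) (hS : ∀ i, (S i).PosDef)
    (hLMI : (net.lmiMatrix P Q S X).PosDef) :
    ∃ ε > 0, ∀ (e : StateIdx N → ℝ) (z : Fin N → StateIdx N → ℝ) (r : StateIdx N → ℝ),
      r = (net.Y P X)ᵀ *ᵥ stackVec e z →
      ε * (e ⬝ᵥ e + ∑ i, z i ⬝ᵥ z i) ≤ -(2 * (e ⬝ᵥ r)) - ∑ i, e ⬝ᵥ Q i *ᵥ e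
        + ∑ i, z i ⬝ᵥ Q i *ᵥ z i + ∑ i, (z i - e) ⬝ᵥ ((2 : ℝ) • P - S i) *ᵥ (z i - e)
        - ∑ i, net.τf i ^ 2 * (r ⬝ᵥ (S i)⁻¹ *ᵥ r) := by
  obtain ⟨ε, hε, hle⟩ := hLMI.exists_coercive
  refine ⟨ε, hε, fun e z r hr => ?_⟩
  -- The minimizer of `2 yᵀr + τ_i⁻² yᵀS_i y`, with minimum `-τ_i² rᵀS_i⁻¹r`.
  set y : Fin N → StateIdx N → ℝ := fun i => -(net.τf i ^ 2) • ((S i)⁻¹ *ᵥ r) with hy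
  have h := hle (stackVec (stackVec e z) y)
  rw [dotProduct_lmiMatrix_mulVec net Q S X hP, ← hr] at h
  have hself : stackVec (stackVec e z) y ⬝ᵥ stackVec (stackVec e z) y =
      e ⬝ᵥ e + ∑ i, z i ⬝ᵥ z i + ∑ i, y i ⬝ᵥ y i := by
    rw [stackVec, sumElim_dotProduct_sumElim, stackVec, sumElim_dotProduct_sumElim,
      dotProduct_curry, dotProduct_curry]
  have hy0 : 0 ≤ ∑ i, y i ⬝ᵥ y i :=
    Finset.sum_nonneg fun i _ => Finset.sum_nonneg fun k _ => mul_self_nonneg _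
  have hyr : ∀ i, y i ⬝ᵥ r = -(net.τf i ^ 2 * (r ⬝ᵥ (S i)⁻¹ *ᵥ r)) := fun i => by
    rw [hy, smul_dotProduct, dotProduct_comm, smul_eq_mul, neg_mul]
  have hyS : ∀ i, 1 / net.τf i ^ 2 * (y i ⬝ᵥ S i *ᵥ y i) =
      net.τf i ^ 2 * (r ⬝ᵥ (S i)⁻¹ *ᵥ r) := fun i => by
    have hτ := (net.τf_pos i).ne'
    have hSy : S i *ᵥ y i = -(net.τf i ^ 2) • r := by
      rw [hy, mulVec_smul, (hS i).mulVec_inv_mulVec]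
    rw [hSy, dotProduct_smul, hyr, smul_eq_mul]
    field_simp
  simp only [hyr, hyS, Finset.sum_neg_distrib] at h
  rw [hself, mul_add ε] at h
  linarith [mul_nonneg hε.le hy0]

end QuadraticForm

/-! ### The observation error. -/

section ErrorDynamics

variable {N : ℕ} (net : TCPNetwork N)

/-- `Ā_d` ignores `δb` and `d`, and `Ā_{d_i}` reads only the `i`-th rate, so delaying the whole
state by `τ i` changes nothing. -/
theorem AdBar_mulVec_delayed (τ : Fin N → ℝ) (x : ℝ → StateIdx N → ℝ) (t : ℝ) :
    net.AdBar *ᵥ delayed τ x t = ∑ i, net.Adi i *ᵥ x (t - τ i) := by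
  ext ((r | r) | r) <;>
    simp [TCPNetwork.AdBar, TCPNetwork.Ad, TCPNetwork.Adi, delayed, mulVec, dotProduct,
      mul_comm]

theorem IsDelaySolution.continuousOn_delayed {τ : Fin N → ℝ} {t₀ : ℝ}
    {F : ℝ → (StateIdx N → ℝ) → (StateIdx N → ℝ) → (StateIdx N → ℝ)}
    {x : ℝ → StateIdx N → ℝ} (hx : IsDelaySolution τ t₀ F x) :
    ContinuousOn (delayed τ x) (Set.Ici t₀) := by
  refine continuousOn_pi.2 ?_
  rintro ((i | k) | k)
  · exact (hx.history i).comp (continuous_sub_right (τ i)).continuousOn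
      fun t ht => sub_le_sub_right (show t₀ ≤ t from ht) _
  · exact continuousOn_pi.1 hx.continuousOn _
  · exact continuousOn_pi.1 hx.continuousOn _

/-- With a merely integrable input each solution satisfies only an integral equation; the input
cancels in the difference, whose right-hand side is continuous. -/
theorem IsDelaySolution.hasDerivAt_sub {τ : Fin N → ℝ} {t₀ : ℝ}
    {F F' : ℝ → (StateIdx N → ℝ) → (StateIdx N → ℝ) → (StateIdx N → ℝ)}
    {x x' w : ℝ → StateIdx N → ℝ} (hx : IsDelaySolution τ t₀ F x)
    (hx' : IsDelaySolution τ t₀ F' x') (hw : ContinuousOn w (Set.Ici t₀))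
    (hF : ∀ t, F' t (x' t) (delayed τ x' t) - F t (x t) (delayed τ x t) = w t)
    {t : ℝ} (ht : t₀ < t) : HasDerivAt (fun s => x' s - x s) (w t) t := by
  have hint : HasDerivAt (fun s => (x' t₀ - x t₀) + ∫ r in t₀..s, w r) (w t) t := by
    refine (intervalIntegral.integral_hasDerivAt_right ?_ ?_ ?_).const_add _
    · refine (hw.mono ?_).intervalIntegrable
      rw [Set.uIcc_of_le ht.le]
      exact Set.Icc_subset_Ici_self
    · exact (hw.mono Set.Ioi_subset_Ici_self).stronglyMeasurableAtFilter isOpen_Ioi t ht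
    · exact hw.continuousAt (Ici_mem_nhds ht)
  refine hint.congr_of_eventuallyEq ?_
  filter_upwards [Ioi_mem_nhds ht] with s hs
  have hs' : t₀ ≤ s := le_of_lt hs
  rw [hx.eq_integral s hs', hx'.eq_integral s hs', add_sub_add_comm,
    ← intervalIntegral.integral_sub (hx'.intervalIntegrable s hs') (hx.intervalIntegrable s hs')]
  simp only [hF]

end ErrorDynamics

theorem theorem2 {N : ℕ} (net : TCPNetwork N)
    (P : Matrix (StateIdx N) (StateIdx N) ℝ)
    (Q S : Fin N → Matrix (StateIdx N) (StateIdx N) ℝ)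
    (X : Matrix (StateIdx N) Unit ℝ)
    (hP : P.PosDef) (hQ : ∀ i, (Q i).PosDef) (hS : ∀ i, (S i).PosDef)
    (hLMI : (net.lmiMatrix P Q S X).PosDef) :
    net.IsAsymptoticObserver (P⁻¹ * X) := by
  intro t₀ u x xhat hx hxhat
  set K : Matrix (StateIdx N) (StateIdx N) ℝ := net.Abar - P⁻¹ * X * outCbar N with hK
  set w : ℝ → StateIdx N → ℝ := fun t =>
    K *ᵥ (xhat t - x t) + net.AdBar *ᵥ (delayed net.τf xhat t - delayed net.τf x t) with hw
  have hwc : ContinuousOn w (Set.Ici t₀) :=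
    ((hxhat.continuousOn.sub hx.continuousOn).matrix_mulVec K).add
      ((hxhat.continuousOn_delayed.sub hx.continuousOn_delayed).matrix_mulVec net.AdBar)
  -- Thus `P K = P Ā - X C̄`, the first block of `Yᵀ`, so that `r = P ė` is `Yᵀ` applied to the
  -- error and its delays.
  have hPX : P * (P⁻¹ * X) = X := by
    rw [← Matrix.mul_assoc, mul_nonsing_inv _ ((isUnit_iff_isUnit_det P).1 hP.isUnit),
      Matrix.one_mul]
  obtain ⟨ε, hε, hform⟩ := exists_quadratic_form_le net hP hS hLMI
  refine delay_stable_of_quadratic_form net.τf_pos (K := K) (A := net.Adi) hP hQ hS hε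
    (fun e z r hr => hform e z r ?_) (t₀ := t₀) (w := w)
    (fun t ht => hx.hasDerivAt_sub hxhat hwc (fun s => ?_) ht)
    (hwc.mono Set.Ioi_subset_Ici_self) (fun t _ => ?_)
  · rw [hr, Y_transpose_mulVec, mulVec_add, mulVec_mulVec, hK, Matrix.mul_sub,
      ← Matrix.mul_assoc P, hPX, mulVec_sum]
    simp only [mulVec_mulVec]
  · simp only [hw, hK, sub_mulVec, mulVec_sub, mulVec_mulVec]
    abel
  · simp only [hw, mulVec_sub, AdBar_mulVec_delayed, Finset.sum_sub_distrib]
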